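/- Let $M$ be a smooth manifold of dimension $2n+1$. A paracontact metric structure $(\varphi,\xi,\eta,g)$ on $M$ consists of a smooth $(1,1)$-tensor field $\varphi$, a smooth vector field $\xi$, a smooth $1$-form $\eta$ and a pseudo-Riemannian metric $g$ such that $\varphi\xi=0$, $\eta\circ\varphi=0$, $\eta(\xi)=1$, $\varphi^2=\mathrm{id}-\eta\otimes\xi$, $g(\varphi X,\varphi Y)=-g(X,Y)+\eta(X)\eta(Y)$ and $g(X,\varphi Y)=d\eta(X,Y)$, where $d\eta(X,Y)=\frac12\bigl(X\eta(Y)-Y\eta(X)-\eta([X,Y])\bigr)$. It is paraSasakian if moreover $$[\varphi X,\varphi Y]-\varphi[\varphi X,Y]-\varphi[X,\varphi Y]+\varphi^2[X,Y]=2\,d\eta(X,Y)\,\xi$$ for all vector fields $X,Y$. A paraholomorphic section at $p\in M$ is a plane in $T_pM$ spanned by $\varphi v$ and $\varphi^2v$, where $v\in T_pM$ and $g(\varphi v,\varphi v)\neq0$. With the curvature tensor $R(X,Y)=[\nabla_X,\nabla_Y]-\nabla_{[X,Y]}$ of the Levi-Civita connection $\nabla$ of $g$, the sectional curvature of a non-degenerate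 plane spanned by $x,y$ is $\dfrac{g(R(x,y)y,x)}{g(x,x)g(y,y)-g(x,y)^2}$. The structure has constant paraholomorphic sectional curvature $k\in\mathbb R$ if every paraholomorphic section at every point of $M$ has sectional curvature $k$. **Theorem 4.3.** Let $(\varphi,\xi,\eta,g)$ be a paraSasakian structure on $M$ with constant paraholomorphic sectional curvature $k$, let $\alpha>0$ be a constant, and let $(\overline\varphi,\overline\xi,\overline\eta,\overline g)$ be obtained from it by the $\mathcal D$-homothetic transformation $$\overline\varphi=\varphi,\qquad \overline\xi=\tfrac1\alpha\,\xi,\qquad \overline\eta=\alpha\,\eta,\qquad \overline g=\alpha\,g+(\alpha^2-\alpha)\,\eta\otimes\eta .$$ Then $(\overline\varphi,\overline\xi,\overline\eta,\overline g)$ is a paraSasakian structure on $M$ with constant paraholomorphic sectional curvature $\dfrac{k-3}{\alpha}+3$. -/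

import Mathlib

open scoped Manifold ContDiff Bundle

noncomputable section

namespace ParaSasaki

section

variable {E : Type*} [NormedAddCommGroup E] [NormedSpace ℝ E]

/-! ### Riemann curvature in coordinates

`G` is a field of symmetric non-degenerate bilinear forms on (an open subset of) the vector space
`E`; vectors of `E` are regarded as constant (hence commuting) coordinate vector fields. -/

/-- The Levi-Civita derivative `∇_u v` at `x` of the constant vector field `v` in the direction
`u`, i.e. the Christoffel symbols of `G` at `x`: the vector determined by the Koszul formula
`2 G(∇_u v, z) = u G(v, z) + v G(u, z) - z G(u, v)`. -/
def christoffel (G : E → E →L[ℝ] E →L[ℝ] ℝ) (x u v : E) : E :=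
  (G x).inverse ((1 / 2 : ℝ) •
    (fderiv ℝ G x u v + fderiv ℝ G x v u - ((fderiv ℝ G x).flip u).flip v))

/-- The curvature `R(u, v) w = ∇_u ∇_v w - ∇_v ∇_u w` at `x`, for constant vector fields
`u`, `v`, `w` (for which `[u, v] = 0`). -/
def chartCurvature (G : E → E →L[ℝ] E →L[ℝ] ℝ) (x u v w : E) : E :=
  fderiv ℝ (fun y => christoffel G y v w) x u - fderiv ℝ (fun y => christoffel G y u w) x v
    + christoffel G x u (christoffel G x v w) - christoffel G x v (christoffel G x u w)

variable {M : Type*} [TopologicalSpace M] [ChartedSpace E M]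

/-- The coordinate expression, in the preferred chart at `p`, of a field `g` of bilinear forms on
the tangent spaces: the pullback of `g` under the inverse of the chart. -/
def chartMetric
    (g : ∀ p : M, TangentSpace 𝓘(ℝ, E) p →L[ℝ] TangentSpace 𝓘(ℝ, E) p →L[ℝ] ℝ)
    (p : M) (x : E) : E →L[ℝ] E →L[ℝ] ℝ :=
  let ψ : E → M := (extChartAt 𝓘(ℝ, E) p).symm
  let A : E →L[ℝ] E := mfderiv 𝓘(ℝ, E) 𝓘(ℝ, E) ψ x
  let B : E →L[ℝ] E →L[ℝ] ℝ := g (ψ x)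
  B.bilinearComp A A

/-- The Riemann tensor `R(u, v, w, z) = g(R(u, v) w, z)` of the metric `g` at the point `p`, with
`R(X, Y) = [∇_X, ∇_Y] - ∇_[X, Y]`, computed in the preferred chart at `p`. -/
def riemann
    (g : ∀ p : M, TangentSpace 𝓘(ℝ, E) p →L[ℝ] TangentSpace 𝓘(ℝ, E) p →L[ℝ] ℝ)
    (p : M) (u v w z : TangentSpace 𝓘(ℝ, E) p) : ℝ :=
  let x : E := extChartAt 𝓘(ℝ, E) p p
  let A : TangentSpace 𝓘(ℝ, E) p →L[ℝ] E :=
    mfderiv 𝓘(ℝ, E) 𝓘(ℝ, E) (extChartAt 𝓘(ℝ, E) p) p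
  chartMetric g p x (chartCurvature (chartMetric g p) x (A u) (A v) (A w)) (A z)

/-- The sectional curvature of the plane spanned by the tangent vectors `u`, `v` at `p`
(meaningful when the plane is non-degenerate, i.e. when the denominator does not vanish). -/
def sectionalCurvature
    (g : ∀ p : M, TangentSpace 𝓘(ℝ, E) p →L[ℝ] TangentSpace 𝓘(ℝ, E) p →L[ℝ] ℝ)
    (p : M) (u v : TangentSpace 𝓘(ℝ, E) p) : ℝ :=
  riemann g p u v v u / (g p u u * g p v v - g p u v ^ 2)

/-! ### Structure tensors -/

variable (E M) in
/-- The raw data of an almost paracontact metric structure on `M`: a field `φ` of endomorphisms, a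
vector field `ξ`, a field `η` of covectors and a field `g` of bilinear forms. All conditions on
them are in `IsParacontactMetric` and `IsParaSasakian`. -/
structure StructureTensors where
  φ : ∀ p : M, TangentSpace 𝓘(ℝ, E) p →L[ℝ] TangentSpace 𝓘(ℝ, E) p
  ξ : ∀ p : M, TangentSpace 𝓘(ℝ, E) p
  η : ∀ p : M, TangentSpace 𝓘(ℝ, E) p →L[ℝ] ℝ
  g : ∀ p : M, TangentSpace 𝓘(ℝ, E) p →L[ℝ] TangentSpace 𝓘(ℝ, E) p →L[ℝ] ℝ

/-- `X` is a smooth vector field near `p`. -/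
def SmoothFieldAt [IsManifold 𝓘(ℝ, E) ∞ M]
    (X : ∀ q : M, TangentSpace 𝓘(ℝ, E) q) (p : M) : Prop :=
  ∀ᶠ q in nhds p, ContMDiffAt 𝓘(ℝ, E) (𝓘(ℝ, E).prod 𝓘(ℝ, E)) ∞
    (fun r => (⟨r, X r⟩ : TangentBundle 𝓘(ℝ, E) M)) q

namespace StructureTensors

variable (S : StructureTensors E M)

/-- `dη(X, Y) = ½ (X η(Y) - Y η(X) - η([X, Y]))` at the point `p`. -/
def dη (X Y : ∀ q : M, TangentSpace 𝓘(ℝ, E) q) (p : M) : ℝ :=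
  (1 / 2 : ℝ) * (mvfderiv 𝓘(ℝ, E) (fun q => S.η q (Y q)) p (X p)
    - mvfderiv 𝓘(ℝ, E) (fun q => S.η q (X q)) p (Y p)
    - S.η p (VectorField.mlieBracket 𝓘(ℝ, E) X Y p))

/-- The Nijenhuis tensor
`N_φ(X, Y) = [φX, φY] - φ[φX, Y] - φ[X, φY] + φ²[X, Y]` at the point `p`. -/
def nijenhuis (X Y : ∀ q : M, TangentSpace 𝓘(ℝ, E) q) (p : M) : TangentSpace 𝓘(ℝ, E) p :=
  VectorField.mlieBracket 𝓘(ℝ, E) (fun q => S.φ q (X q)) (fun q => S.φ q (Y q)) p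
    - S.φ p (VectorField.mlieBracket 𝓘(ℝ, E) (fun q => S.φ q (X q)) Y p)
    - S.φ p (VectorField.mlieBracket 𝓘(ℝ, E) X (fun q => S.φ q (Y q)) p)
    + S.φ p (S.φ p (VectorField.mlieBracket 𝓘(ℝ, E) X Y p))

/-- All paraholomorphic sectional curvatures equal `k`: for every point `p` and every tangent vector
`v` with `φv` non-isotropic, the section spanned by `φv` and `φ²v` has sectional curvature `k`. -/
def HasConstantParaholomorphicCurvature (k : ℝ) : Prop :=
  ∀ (p : M) (v : TangentSpace 𝓘(ℝ, E) p), S.g p (S.φ p v) (S.φ p v) ≠ 0 →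
    sectionalCurvature S.g p (S.φ p v) (S.φ p (S.φ p v)) = k

/-- The `D`-homothetic transformation with constant `α`:
`φ ↦ φ`, `ξ ↦ α⁻¹ ξ`, `η ↦ α η`, `g ↦ α g + (α² - α) η ⊗ η`. -/
def dHomothetic (α : ℝ) : StructureTensors E M where
  φ := S.φ
  ξ := fun p => α⁻¹ • S.ξ p
  η := fun p => α • S.η p
  g := fun p => α • S.g p + (α ^ 2 - α) • (S.η p).smulRight (S.η p)

variable [IsManifold 𝓘(ℝ, E) ∞ M]

/-- `(φ, ξ, η, g)` is a paracontact metric structure: smooth tensor fields, `g` a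
pseudo-Riemannian metric, with the compatibility conditions (the last one is
`g(X, φY) = dη(X, Y)` for all smooth vector fields, at every point). -/
structure IsParacontactMetric : Prop where
  smooth_φ : ContMDiff 𝓘(ℝ, E) (𝓘(ℝ, E).prod 𝓘(ℝ, E →L[ℝ] E)) ∞
    (fun p : M => Bundle.TotalSpace.mk' (E →L[ℝ] E)
      (E := fun q : M => TangentSpace 𝓘(ℝ, E) q →L[ℝ] TangentSpace 𝓘(ℝ, E) q) p (S.φ p))
  smooth_ξ : ContMDiff 𝓘(ℝ, E) (𝓘(ℝ, E).prod 𝓘(ℝ, E)) ∞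
    (fun p => (⟨p, S.ξ p⟩ : TangentBundle 𝓘(ℝ, E) M))
  smooth_η : ContMDiff 𝓘(ℝ, E) (𝓘(ℝ, E).prod 𝓘(ℝ, E →L[ℝ] ℝ)) ∞
    (fun p : M => Bundle.TotalSpace.mk' (E →L[ℝ] ℝ)
      (E := fun q : M => TangentSpace 𝓘(ℝ, E) q →L[ℝ] ℝ) p (S.η p))
  smooth_g : ContMDiff 𝓘(ℝ, E) (𝓘(ℝ, E).prod 𝓘(ℝ, E →L[ℝ] E →L[ℝ] ℝ)) ∞
    (fun p : M => Bundle.TotalSpace.mk' (E →L[ℝ] E →L[ℝ] ℝ)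
      (E := fun q : M => TangentSpace 𝓘(ℝ, E) q →L[ℝ] TangentSpace 𝓘(ℝ, E) q →L[ℝ] ℝ) p (S.g p))
  g_symm : ∀ (p : M) (u v : TangentSpace 𝓘(ℝ, E) p), S.g p u v = S.g p v u
  g_nondegenerate : ∀ (p : M) (u : TangentSpace 𝓘(ℝ, E) p), (∀ v, S.g p u v = 0) → u = 0
  φ_ξ : ∀ p : M, S.φ p (S.ξ p) = 0
  η_φ : ∀ (p : M) (u : TangentSpace 𝓘(ℝ, E) p), S.η p (S.φ p u) = 0
  η_ξ : ∀ p : M, S.η p (S.ξ p) = 1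
  φ_φ : ∀ (p : M) (u : TangentSpace 𝓘(ℝ, E) p), S.φ p (S.φ p u) = u - S.η p u • S.ξ p
  g_φ_φ : ∀ (p : M) (u v : TangentSpace 𝓘(ℝ, E) p),
    S.g p (S.φ p u) (S.φ p v) = - S.g p u v + S.η p u * S.η p v
  g_φ : ∀ (p : M) (X Y : ∀ q : M, TangentSpace 𝓘(ℝ, E) q),
    SmoothFieldAt X p → SmoothFieldAt Y p → S.g p (X p) (S.φ p (Y p)) = S.dη X Y p

/-- A paraSasakian structure: a paracontact metric structure with `N_φ(X, Y) = 2 dη(X, Y) ξ`. -/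
structure IsParaSasakian : Prop extends S.IsParacontactMetric where
  nijenhuis_eq : ∀ (p : M) (X Y : ∀ q : M, TangentSpace 𝓘(ℝ, E) q),
    SmoothFieldAt X p → SmoothFieldAt Y p → S.nijenhuis X Y p = (2 * S.dη X Y p) • S.ξ p

end StructureTensors

end

end ParaSasaki

end

/-!
A `D`-homothetic transformation changes the Levi-Civita connection by a tensor that is explicit in
`φ` and `η`, and on horizontal vectors (those annihilated by `η`) the resulting change of curvature
is algebraic.

The condition on the Nijenhuis tensor, applied to a pair `(v, ξ)`, shows that `ξ` preserves `φ`
(`lieDeriv_φ`). It also preserves the fundamental form `g(·, φ ·) = dη`, which is closed and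
annihilated by `ξ` (`lieDeriv_fundamentalForm`). Hence `ξ` is a Killing field (`lieDeriv_G`), and so
`(∇_u η)(w) = g(u, φ w)` (`covariantDeriv_η`). By the Koszul formula the connection of
`α g + (α² - α) η ⊗ η` is then `∇ + (1 - α) (η ⊗ φ + φ ⊗ η)` (`christoffel_dHomotheticForm`).

When the curvature of the new connection is expanded on horizontal vectors, every term with a
derivative of `φ` carries a factor `η` of a horizontal vector, so only derivatives of `η` survive
(`chartCurvature_dHomotheticForm`). On the section spanned by a horizontal `u` and `φ u` one obtains
`R'(u, φu, φu, u) = α (R(u, φu, φu, u) + 3 (1 - α) g(u, u)²)`, while the Gram determinant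
`- g(u, u)²` is multiplied by `α²`. Therefore the sectional curvature `k` becomes
`(k - 3 (1 - α)) / α = (k - 3) / α + 3`.

All of this takes place in the target of a chart. `IsParaSasakian.isLocalParaSasakian` transports
the structure there, by evaluating the conditions on `dη` and on the Nijenhuis tensor on vector
fields with constant components, and on `ξ`. It is applied to the original structure and also to
the transformed one, whose structure equations are checked directly on the manifold
(`IsParaSasakian.dHomothetic`).
-/

-- Normed space structures on iterated spaces of continuous linear maps are not found otherwise.
set_option maxSynthPendingDepth 3

noncomputable section

namespace ParaSasaki

open Filter Bundle

/-! ### ParaSasakian structures on an open subset of a vector space -/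

section Local

variable {E : Type*} [NormedAddCommGroup E] [NormedSpace ℝ E]

lemma differentiableAt_flip {F F' F'' : Type*} [NormedAddCommGroup F] [NormedSpace ℝ F]
    [NormedAddCommGroup F'] [NormedSpace ℝ F'] [NormedAddCommGroup F''] [NormedSpace ℝ F'']
    {A : E → F →L[ℝ] F' →L[ℝ] F''} {x : E} (hA : DifferentiableAt ℝ A x) :
    DifferentiableAt ℝ (fun y => (A y).flip) x :=
  (ContinuousLinearMap.flipₗᵢ ℝ F F' F'').toContinuousLinearEquiv.differentiableAt.comp x hA

/-- A paraSasakian structure written in coordinates on an open subset `U` of a vector space. The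
condition on `dη` is required for constant fields only, and of the condition on the Nijenhuis tensor
only the case `N_φ(v, ξ) = 0` with `v` constant is retained. -/
structure IsLocalParaSasakian (U : Set E) (φ : E → E →L[ℝ] E) (ξ : E → E) (η : E → E →L[ℝ] ℝ)
    (G : E → E →L[ℝ] E →L[ℝ] ℝ) : Prop where
  isOpen : IsOpen U
  smooth_φ : ∀ x ∈ U, ContDiffAt ℝ ∞ φ x
  smooth_ξ : ∀ x ∈ U, ContDiffAt ℝ ∞ ξ x
  smooth_η : ∀ x ∈ U, ContDiffAt ℝ ∞ η x
  smooth_G : ∀ x ∈ U, ContDiffAt ℝ ∞ G x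
  G_symm : ∀ x ∈ U, ∀ u v, G x u v = G x v u
  G_nondegenerate : ∀ x ∈ U, ∀ u, (∀ v, G x u v = 0) → u = 0
  φ_ξ : ∀ x ∈ U, φ x (ξ x) = 0
  η_φ : ∀ x ∈ U, ∀ u, η x (φ x u) = 0
  η_ξ : ∀ x ∈ U, η x (ξ x) = 1
  φ_φ : ∀ x ∈ U, ∀ u, φ x (φ x u) = u - η x u • ξ x
  G_φ_φ : ∀ x ∈ U, ∀ u v, G x (φ x u) (φ x v) = - G x u v + η x u * η x v
  G_φ : ∀ x ∈ U, ∀ u v, G x u (φ x v) = (1 / 2 : ℝ) * (fderiv ℝ η x u v - fderiv ℝ η x v u)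
  nijenhuis_ξ : ∀ x ∈ U, ∀ v, φ x (φ x (fderiv ℝ ξ x v))
    - φ x (fderiv ℝ ξ x (φ x v) - fderiv ℝ φ x (ξ x) v) = 0

namespace IsLocalParaSasakian

variable {U : Set E} {φ : E → E →L[ℝ] E} {ξ : E → E} {η : E → E →L[ℝ] ℝ}
  {G : E → E →L[ℝ] E →L[ℝ] ℝ} (h : IsLocalParaSasakian U φ ξ η G) {x : E} (hx : x ∈ U)

include h hx

lemma differentiableAt_φ : DifferentiableAt ℝ φ x := (h.smooth_φ x hx).differentiableAt (by simp)
lemma differentiableAt_ξ : DifferentiableAt ℝ ξ x := (h.smooth_ξ x hx).differentiableAt (by simp)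
lemma differentiableAt_η : DifferentiableAt ℝ η x := (h.smooth_η x hx).differentiableAt (by simp)
lemma differentiableAt_G : DifferentiableAt ℝ G x := (h.smooth_G x hx).differentiableAt (by simp)

lemma mem_nhds : U ∈ nhds x := h.isOpen.mem_nhds hx


lemma η_eq (v : E) : η x v = G x (ξ x) v := by
  have := h.G_φ_φ x hx (ξ x) v
  simp only [h.φ_ξ x hx, h.η_ξ x hx, map_zero, zero_apply, one_mul] at this
  linarith

lemma φ_skew (u v : E) : G x u (φ x v) = - G x (φ x u) v := by
  rw [h.G_symm x hx (φ x u) v, h.G_φ x hx, h.G_φ x hx]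
  ring

lemma fderiv_φ_ξ (u : E) : fderiv ℝ φ x u (ξ x) = - φ x (fderiv ℝ ξ x u) := by
  have h1 : (fun y => φ y (ξ y)) =ᶠ[nhds x] fun _ => (0 : E) :=
    eventually_of_mem (h.mem_nhds hx) fun y hy => h.φ_ξ y hy
  have h2 := congrArg (· u) (h1.fderiv_eq (𝕜 := ℝ))
  simp only [fderiv_clm_apply (h.differentiableAt_φ hx) (h.differentiableAt_ξ hx)] at h2
  simp at h2
  rwa [add_comm, add_eq_zero_iff_eq_neg] at h2

lemma fderiv_η_ξ (u : E) : fderiv ℝ η x u (ξ x) = - η x (fderiv ℝ ξ x u) := by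
  have h1 : (fun y => η y (ξ y)) =ᶠ[nhds x] fun _ => (1 : ℝ) :=
    eventually_of_mem (h.mem_nhds hx) fun y hy => h.η_ξ y hy
  have h2 := congrArg (· u) (h1.fderiv_eq (𝕜 := ℝ))
  simp only [fderiv_clm_apply (h.differentiableAt_η hx) (h.differentiableAt_ξ hx)] at h2
  simp at h2
  rwa [add_comm, add_eq_zero_iff_eq_neg] at h2

lemma fderiv_η_φ (u v : E) : fderiv ℝ η x u (φ x v) = - η x (fderiv ℝ φ x u v) := by
  have h1 : (fun y => η y (φ y v)) =ᶠ[nhds x] fun _ => (0 : ℝ) :=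
    eventually_of_mem (h.mem_nhds hx) fun y hy => h.η_φ y hy v
  have h2 := congrArg (· u) (h1.fderiv_eq (𝕜 := ℝ))
  have hd : DifferentiableAt ℝ (fun y => φ y v) x := by
    have := h.differentiableAt_φ hx
    fun_prop
  simp only [fderiv_clm_apply (h.differentiableAt_η hx) hd,
    fderiv_clm_apply (h.differentiableAt_φ hx) (differentiableAt_const v)] at h2
  simp at h2
  rwa [add_comm, add_eq_zero_iff_eq_neg] at h2

lemma fderiv_η (u v : E) :
    fderiv ℝ η x u v = fderiv ℝ G x u (ξ x) v + G x (fderiv ℝ ξ x u) v := by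
  have h1 : η =ᶠ[nhds x] fun y => G y (ξ y) :=
    eventually_of_mem (h.mem_nhds hx) fun y hy => ContinuousLinearMap.ext (h.η_eq hy)
  rw [h1.fderiv_eq, fderiv_clm_apply (h.differentiableAt_G hx) (h.differentiableAt_ξ hx)]
  simp [add_comm]

lemma fderiv_G_symm (w u v : E) : fderiv ℝ G x w u v = fderiv ℝ G x w v u := by
  have h1 : (fun y => G y u v) =ᶠ[nhds x] fun y => G y v u :=
    eventually_of_mem (h.mem_nhds hx) fun y hy => h.G_symm y hy u v
  have h2 := congrArg (· w) (h1.fderiv_eq (𝕜 := ℝ))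
  have hd := h.differentiableAt_G hx
  have hd' (a : E) : DifferentiableAt ℝ (fun y => G y a) x := by fun_prop
  simp only [fderiv_clm_apply (hd' _) (differentiableAt_const _),
    fderiv_clm_apply hd (differentiableAt_const _)] at h2
  simpa using h2

/-- The exterior derivative of `η` vanishes on `ξ`. -/
lemma fderiv_η_ξ_comm (u : E) : fderiv ℝ η x u (ξ x) = fderiv ℝ η x (ξ x) u := by
  have := h.G_φ x hx u (ξ x)
  rw [h.φ_ξ x hx, map_zero] at this
  linarith

/-- The tensor `φ` is invariant under the flow of `ξ`: the condition on the Nijenhuis tensor says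
that `L_ξ φ` takes its values in the kernel of `φ`, and `dη(ξ, ·) = 0` that `η ∘ L_ξ φ = 0`. -/
lemma lieDeriv_φ (v : E) :
    fderiv ℝ φ x (ξ x) v - fderiv ℝ ξ x (φ x v) + φ x (fderiv ℝ ξ x v) = 0 := by
  set w := fderiv ℝ φ x (ξ x) v - fderiv ℝ ξ x (φ x v) + φ x (fderiv ℝ ξ x v) with hw
  have h1 : φ x w = 0 := by
    rw [← h.nijenhuis_ξ x hx v, hw]
    simp only [map_add, map_sub]
    abel
  have h2 : η x w = 0 := by
    have a := h.fderiv_η_φ hx (ξ x) v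
    have b := h.fderiv_η_ξ hx (φ x v)
    have c := h.fderiv_η_ξ_comm hx (φ x v)
    simp only [hw, map_add, map_sub, h.η_φ x hx]
    linarith
  have h3 := h.φ_φ x hx w
  rw [h1, h2, map_zero, zero_smul, sub_zero] at h3
  exact h3.symm

lemma fderiv_fundamentalForm (w u v : E) :
    fderiv ℝ G x w u (φ x v) + G x u (fderiv ℝ φ x w v) =
      (1 / 2 : ℝ) * (fderiv ℝ (fderiv ℝ η) x w u v - fderiv ℝ (fderiv ℝ η) x w v u) := by
  have h1 : (fun y => G y u (φ y v)) =ᶠ[nhds x]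
      fun y => (1 / 2 : ℝ) * (fderiv ℝ η y u v - fderiv ℝ η y v u) :=
    eventually_of_mem (h.mem_nhds hx) fun y hy => h.G_φ y hy u v
  have h2 := congrArg (· w) (h1.fderiv_eq (𝕜 := ℝ))
  have hd := h.differentiableAt_G hx
  have hd' : DifferentiableAt ℝ (fun y => G y u) x := by fun_prop
  have hφ := h.differentiableAt_φ hx
  have hφ' : DifferentiableAt ℝ (fun y => φ y v) x := by fun_prop
  have hη : DifferentiableAt ℝ (fderiv ℝ η) x :=
    ((h.smooth_η x hx).fderiv_right (m := 1) (by norm_cast)).differentiableAt (by simp)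
  have hη' (a : E) : DifferentiableAt ℝ (fun y => fderiv ℝ η y a) x := by fun_prop
  have hη'' (a b : E) : DifferentiableAt ℝ (fun y => fderiv ℝ η y a b) x := by fun_prop
  simp only [fderiv_clm_apply hd' hφ', fderiv_clm_apply hd (differentiableAt_const _),
    fderiv_clm_apply hφ (differentiableAt_const _),
    fderiv_const_mul ((hη'' u v).fun_sub (hη'' v u)), fderiv_fun_sub (hη'' u v) (hη'' v u),
    fderiv_clm_apply (hη' _) (differentiableAt_const _),
    fderiv_clm_apply hη (differentiableAt_const _)] at h2
  simp at h2
  rw [add_comm, h2]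
  ring

/-- The vector field `ξ` preserves the fundamental form `G(·, φ ·) = dη`, because that form is
closed and vanishes on `ξ`. -/
lemma lieDeriv_fundamentalForm (u v : E) :
    fderiv ℝ G x (ξ x) u (φ x v) + G x u (fderiv ℝ φ x (ξ x) v)
      + G x (fderiv ℝ ξ x u) (φ x v) + G x u (φ x (fderiv ℝ ξ x v)) = 0 := by
  have hs : IsSymmSndFDerivAt ℝ η x :=
    (h.smooth_η x hx).isSymmSndFDerivAt (by simp; norm_cast)
  have a := h.fderiv_fundamentalForm hx (ξ x) u v
  have b := h.fderiv_fundamentalForm hx u v (ξ x)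
  have c := h.fderiv_fundamentalForm hx v u (ξ x)
  rw [h.φ_ξ x hx, map_zero, h.fderiv_φ_ξ hx, map_neg] at b c
  have d : G x v (φ x (fderiv ℝ ξ x u)) = - G x (fderiv ℝ ξ x u) (φ x v) := by
    rw [h.φ_skew hx, h.G_symm x hx]
  rw [hs.eq (ξ x) u, hs.eq (ξ x) v] at a
  rw [hs.eq u v] at b
  linarith

/-- The vector field `ξ` is Killing. -/
lemma lieDeriv_G (u w : E) :
    fderiv ℝ G x (ξ x) u w + G x (fderiv ℝ ξ x u) w + G x u (fderiv ℝ ξ x w) = 0 := by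
  -- `w` is decomposed into a vector in the image of `φ` and a multiple of `ξ`.
  have key (v : E) : fderiv ℝ G x (ξ x) u (φ x v) + G x (fderiv ℝ ξ x u) (φ x v)
      + G x u (fderiv ℝ ξ x (φ x v)) = 0 := by
    have a := h.lieDeriv_fundamentalForm hx u v
    have b := congrArg (G x u) (h.lieDeriv_φ hx v)
    simp only [map_add, map_sub, map_zero] at b
    linarith
  have hξ : fderiv ℝ G x (ξ x) u (ξ x) + G x (fderiv ℝ ξ x u) (ξ x)
      + G x u (fderiv ℝ ξ x (ξ x)) = 0 := by
    have a := h.fderiv_η hx (ξ x) u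
    have b := h.fderiv_η_ξ hx u
    have c := h.fderiv_η_ξ_comm hx u
    rw [h.fderiv_G_symm hx, h.G_symm x hx] at a
    rw [h.η_eq hx, h.G_symm x hx] at b
    linarith
  have hw : w = φ x (φ x w) + η x w • ξ x := by rw [h.φ_φ x hx]; abel
  have a := key (φ x w)
  rw [hw]
  simp only [map_add, map_smul, smul_eq_mul]
  linear_combination a + η x w * hξ

section Christoffel

variable [FiniteDimensional ℝ E]

lemma isInvertible_G : (G x).IsInvertible := by
  have hinj : Function.Injective (G x) := by
    rw [injective_iff_map_eq_zero]
    intro u hu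
    exact h.G_nondegenerate x hx u fun v => by rw [hu]; rfl
  have hdim : Module.finrank ℝ E = Module.finrank ℝ (E →L[ℝ] ℝ) := by
    rw [← LinearMap.toContinuousLinearMap.finrank_eq (R := ℝ) (M := E →ₗ[ℝ] ℝ)]
    exact (Subspace.dual_finrank_eq (K := ℝ) (V := E)).symm
  let e : E ≃ₗ[ℝ] (E →L[ℝ] ℝ) :=
    LinearEquiv.ofInjectiveOfFinrankEq (G x).toLinearMap hinj hdim
  exact ⟨e.toContinuousLinearEquiv, by ext; rfl⟩

/-- The Koszul formula. -/
lemma G_christoffel (u v z : E) : G x (christoffel G x u v) z =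
    (1 / 2 : ℝ) * (fderiv ℝ G x u v z + fderiv ℝ G x v u z - fderiv ℝ G x z u v) := by
  rw [christoffel, (h.isInvertible_G hx).self_apply_inverse]
  simp

lemma christoffel_eq_of_forall {u v w : E} (hw : ∀ z, G x w z =
    (1 / 2 : ℝ) * (fderiv ℝ G x u v z + fderiv ℝ G x v u z - fderiv ℝ G x z u v)) :
    christoffel G x u v = w := by
  rw [← sub_eq_zero]
  refine h.G_nondegenerate x hx _ fun z => ?_
  rw [map_sub, sub_apply, h.G_christoffel hx, hw, sub_self]

/-- The covariant derivative of `η` is `(∇_u η)(w) = G(u, φ w)`: its symmetric part is half of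
`L_ξ G = 0` and its antisymmetric part is `dη`. -/
lemma covariantDeriv_η (u w : E) :
    fderiv ℝ η x u w - η x (christoffel G x u w) = G x u (φ x w) := by
  have a := h.lieDeriv_G hx u w
  have b := h.G_christoffel hx u w (ξ x)
  rw [h.G_φ x hx, h.η_eq hx, h.G_symm x hx, b]
  have c := h.fderiv_η hx u w
  have d := h.fderiv_η hx w u
  rw [h.fderiv_G_symm hx] at c d
  rw [h.G_symm x hx] at d
  linarith

lemma differentiableAt_christoffel (u v : E) :
    DifferentiableAt ℝ (fun y => christoffel G y u v) x := by
  have hG := h.differentiableAt_G hx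
  have hG' : DifferentiableAt ℝ (fderiv ℝ G) x :=
    ((h.smooth_G x hx).fderiv_right (m := 1) (by norm_cast)).differentiableAt (by simp)
  have hi : DifferentiableAt ℝ (fun y => (G y).inverse) x := by
    have : DifferentiableAt ℝ ContinuousLinearMap.inverse (G x) :=
      ((h.isInvertible_G hx).contDiffAt_map_inverse (n := 1)).differentiableAt (by simp)
    exact this.comp x hG
  unfold christoffel
  have h1 : DifferentiableAt ℝ (fun y => fderiv ℝ G y u v) x := by fun_prop
  have h2 : DifferentiableAt ℝ (fun y => fderiv ℝ G y v u) x := by fun_prop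
  have h3 : DifferentiableAt ℝ (fun y => ((fderiv ℝ G y).flip u).flip v) x :=
    differentiableAt_flip (differentiableAt_flip hG' |>.clm_apply (differentiableAt_const u))
      |>.clm_apply (differentiableAt_const v)
  exact hi.clm_apply (((h1.fun_add h2).fun_sub h3).fun_const_smul _)

end Christoffel

end IsLocalParaSasakian

end Local

/-! ### Effect of a `D`-homothetic transformation on the curvature -/

section Local

variable {E : Type*} [NormedAddCommGroup E] [NormedSpace ℝ E]

/-- The field of bilinear forms `α G + (α² - α) η ⊗ η` on a vector space. -/
def dHomotheticForm (α : ℝ) (η : E → E →L[ℝ] ℝ) (G : E → E →L[ℝ] E →L[ℝ] ℝ) (x : E) :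
    E →L[ℝ] E →L[ℝ] ℝ :=
  α • G x + (α ^ 2 - α) • (η x).smulRight (η x)

namespace IsLocalParaSasakian

variable {U : Set E} {φ : E → E →L[ℝ] E} {ξ ξ' : E → E} {η η' : E → E →L[ℝ] ℝ}
  {G : E → E →L[ℝ] E →L[ℝ] ℝ} {x : E} {α : ℝ}

lemma dHomotheticForm_apply (u v : E) :
    dHomotheticForm α η G x u v = α * G x u v + (α ^ 2 - α) * (η x u * η x v) := by
  simp [dHomotheticForm]

lemma fderiv_dHomotheticForm (h : IsLocalParaSasakian U φ ξ η G) (hx : x ∈ U) (u v w : E) :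
    fderiv ℝ (dHomotheticForm α η G) x u v w = α * fderiv ℝ G x u v w
      + (α ^ 2 - α) * (fderiv ℝ η x u v * η x w + η x v * fderiv ℝ η x u w) := by
  have hG := h.differentiableAt_G hx
  have hη := h.differentiableAt_η hx
  have hη' (a : E) : DifferentiableAt ℝ (fun y => η y a) x := by fun_prop
  have hGv : DifferentiableAt ℝ (fun y => G y v) x := by fun_prop
  have hGvw : DifferentiableAt ℝ (fun y => G y v w) x := by fun_prop
  have hF : DifferentiableAt ℝ (dHomotheticForm α η G) x := by
    have h1 : DifferentiableAt ℝ (fun y => (η y).smulRight (η y)) x :=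
      ((ContinuousLinearMap.smulRightL ℝ E (E →L[ℝ] ℝ)).differentiableAt.comp x hη).clm_apply hη
    exact (hG.fun_const_smul _).fun_add (h1.fun_const_smul _)
  have hFv : DifferentiableAt ℝ (fun y => dHomotheticForm α η G y v) x := by fun_prop
  have h1 : fderiv ℝ (dHomotheticForm α η G) x u v w =
      fderiv ℝ (fun y => dHomotheticForm α η G y v w) x u := by
    rw [fderiv_clm_apply hFv (differentiableAt_const _),
      fderiv_clm_apply hF (differentiableAt_const _)]
    simp
  have h2 : fderiv ℝ G x u v w = fderiv ℝ (fun y => G y v w) x u := by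
    rw [fderiv_clm_apply hGv (differentiableAt_const _),
      fderiv_clm_apply hG (differentiableAt_const _)]
    simp
  have h3 (a : E) : fderiv ℝ η x u a = fderiv ℝ (fun y => η y a) x u := by
    rw [fderiv_clm_apply hη (differentiableAt_const _)]
    simp
  rw [h1, h2, h3 v, h3 w]
  simp only [dHomotheticForm_apply]
  rw [fderiv_fun_add (hGvw.const_mul _) (((hη' v).fun_mul (hη' w)).const_mul _),
    fderiv_const_mul hGvw, fderiv_const_mul ((hη' v).fun_mul (hη' w)),
    fderiv_fun_mul (hη' v) (hη' w)]
  simp only [add_apply, smul_apply, smul_eq_mul]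
  ring

variable [FiniteDimensional ℝ E]

/-- The difference of the two Levi-Civita connections is
`(1 - α) (η(u) φ v + η(v) φ u)`. -/
lemma christoffel_dHomotheticForm (h : IsLocalParaSasakian U φ ξ η G)
    (h' : IsLocalParaSasakian U φ ξ' η' (dHomotheticForm α η G)) (hx : x ∈ U) (u v : E) :
    christoffel (dHomotheticForm α η G) x u v =
      christoffel G x u v + (1 - α) • (η x u • φ x v + η x v • φ x u) := by
  refine h'.christoffel_eq_of_forall hx fun z => ?_
  simp only [h.fderiv_dHomotheticForm hx, dHomotheticForm_apply, map_add, map_smul, add_apply,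
    smul_apply, smul_eq_mul, h.η_φ x hx, h.G_christoffel hx]
  have a := h.covariantDeriv_η hx u v
  have b := h.G_φ x hx u v
  have c := h.G_φ x hx u z
  have d := h.G_φ x hx v z
  rw [h.φ_skew hx] at c d
  linear_combination (α ^ 2 - α) * (η x z * (- a - b) + η x v * c + η x u * d)

/-- The change of curvature on horizontal vectors. The derivative of `φ` does not contribute,
because it comes with a factor `η(u)`, `η(v)` or `η(w)`. -/
lemma chartCurvature_dHomotheticForm (h : IsLocalParaSasakian U φ ξ η G)
    (h' : IsLocalParaSasakian U φ ξ' η' (dHomotheticForm α η G)) (hx : x ∈ U) {u v w : E}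
    (hu : η x u = 0) (hv : η x v = 0) (hw : η x w = 0) :
    chartCurvature (dHomotheticForm α η G) x u v w = chartCurvature G x u v w
      + (1 - α) • ((2 * G x u (φ x v)) • φ x w + G x u (φ x w) • φ x v
        - G x v (φ x w) • φ x u) := by
  have hd {a b c : E} (ha : η x a = 0) (hb : η x b = 0) :
      fderiv ℝ (fun y => christoffel (dHomotheticForm α η G) y a b) x c =
        fderiv ℝ (fun y => christoffel G y a b) x c
          + (1 - α) • (fderiv ℝ η x c a • φ x b + fderiv ℝ η x c b • φ x a) := by
    have h1 : (fun y => christoffel (dHomotheticForm α η G) y a b) =ᶠ[nhds x] fun y =>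
        christoffel G y a b + (1 - α) • (η y a • φ y b + η y b • φ y a) :=
      eventually_of_mem (h.mem_nhds hx) fun y hy => h.christoffel_dHomotheticForm h' hy a b
    have hη := h.differentiableAt_η hx
    have hφ := h.differentiableAt_φ hx
    have hη' (a : E) : DifferentiableAt ℝ (fun y => η y a) x := by fun_prop
    have hφ' (a : E) : DifferentiableAt ℝ (fun y => φ y a) x := by fun_prop
    have h2 (e : E) : fderiv ℝ (fun y => η y e) x c = fderiv ℝ η x c e := by
      rw [fderiv_clm_apply hη (differentiableAt_const _)]
      simp
    have h3 (e f : E) : DifferentiableAt ℝ (fun y => η y e • φ y f) x := (hη' e).fun_smul (hφ' f)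
    rw [h1.fderiv_eq, fderiv_fun_add (h.differentiableAt_christoffel hx a b)
      (((h3 a b).fun_add (h3 b a)).fun_const_smul _),
      fderiv_fun_const_smul ((h3 a b).fun_add (h3 b a)), fderiv_fun_add (h3 a b) (h3 b a),
      fderiv_fun_smul (hη' a) (hφ' b), fderiv_fun_smul (hη' b) (hφ' a)]
    simp [ha, hb, h2]
  have huw := h.covariantDeriv_η hx u w
  have hvw := h.covariantDeriv_η hx v w
  have huv := h.G_φ x hx u v
  rw [chartCurvature, chartCurvature, hd hv hw, hd hu hw, h.christoffel_dHomotheticForm h' hx v w,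
    h.christoffel_dHomotheticForm h' hx u w, hu, hv, hw]
  simp only [zero_smul, add_zero, smul_zero, h.christoffel_dHomotheticForm h' hx, hu, hv, zero_add]
  rw [huv, ← huw, ← hvw]
  module

/-- The sectional curvature of the section spanned by a horizontal vector `u` and `φ u`, before
division by the determinants of the two metrics. -/
lemma dHomotheticForm_chartCurvature_φ (h : IsLocalParaSasakian U φ ξ η G)
    (h' : IsLocalParaSasakian U φ ξ' η' (dHomotheticForm α η G)) (hx : x ∈ U) {u : E}
    (hu : η x u = 0) :
    dHomotheticForm α η G x
        (chartCurvature (dHomotheticForm α η G) x u (φ x u) (φ x u)) u =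
      α * (G x (chartCurvature G x u (φ x u) (φ x u)) u + 3 * (1 - α) * G x u u ^ 2) := by
  have hφφ : φ x (φ x u) = u := by rw [h.φ_φ x hx, hu, zero_smul, sub_zero]
  have hφu : G x (φ x u) u = 0 := by
    have := h.φ_skew hx u u
    rw [h.G_symm x hx u] at this
    linarith
  rw [h.chartCurvature_dHomotheticForm h' hx hu (h.η_φ x hx u) (h.η_φ x hx u),
    dHomotheticForm_apply, hu, hφφ]
  simp only [map_add, map_sub, map_smul, add_apply, sub_apply, smul_apply, smul_eq_mul, hφu]
  ring

end IsLocalParaSasakian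

end Local

/-! ### Tensor fields in the preferred chart -/

section Chart

variable {E : Type*} [NormedAddCommGroup E] [NormedSpace ℝ E]
  {M : Type*} [TopologicalSpace M] [ChartedSpace E M]

/-- The derivative of the inverse of the preferred chart at `p`. -/
def chartFrame (p : M) (x : E) :
    E →L[ℝ] TangentSpace 𝓘(ℝ, E) ((extChartAt 𝓘(ℝ, E) p).symm x) :=
  mfderiv 𝓘(ℝ, E) 𝓘(ℝ, E) (extChartAt 𝓘(ℝ, E) p).symm x

/-- The derivative of the preferred chart at `p`. -/
def chartCoframe (p : M) (x : E) :
    TangentSpace 𝓘(ℝ, E) ((extChartAt 𝓘(ℝ, E) p).symm x) →L[ℝ] E :=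
  mfderiv 𝓘(ℝ, E) 𝓘(ℝ, E) (extChartAt 𝓘(ℝ, E) p) ((extChartAt 𝓘(ℝ, E) p).symm x)

variable {p : M} {x : E}

lemma symm_mem_chart_source (hx : x ∈ (extChartAt 𝓘(ℝ, E) p).target) :
    (extChartAt 𝓘(ℝ, E) p).symm x ∈ (chartAt E p).source := by
  rw [← extChartAt_source 𝓘(ℝ, E) p]
  exact (extChartAt 𝓘(ℝ, E) p).map_target hx

namespace StructureTensors

variable (S : StructureTensors E M)

/-- The coordinate expression of `φ` in the preferred chart at `p`. -/
def chartφ (p : M) (x : E) : E →L[ℝ] E :=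
  (chartCoframe p x).comp ((S.φ _).comp (chartFrame p x))

/-- The coordinate expression of `ξ` in the preferred chart at `p`. -/
def chartξ (p : M) (x : E) : E := chartCoframe p x (S.ξ _)

/-- The coordinate expression of `η` in the preferred chart at `p`. -/
def chartη (p : M) (x : E) : E →L[ℝ] ℝ := (S.η _).comp (chartFrame p x)

lemma chartMetric_apply (u v : E) :
    chartMetric S.g p x u v = S.g _ (chartFrame p x u) (chartFrame p x v) := rfl

end StructureTensors

variable [IsManifold 𝓘(ℝ, E) ∞ M]

lemma chartFrame_eq_symmL (hx : x ∈ (extChartAt 𝓘(ℝ, E) p).target) :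
    chartFrame p x = (trivializationAt E (TangentSpace 𝓘(ℝ, E)) p).symmL ℝ
      ((extChartAt 𝓘(ℝ, E) p).symm x) := by
  have : IsManifold 𝓘(ℝ, E) 1 M := IsManifold.of_le (n := ∞) (by norm_cast)
  rw [TangentBundle.symmL_trivializationAt (symm_mem_chart_source hx),
    (extChartAt 𝓘(ℝ, E) p).right_inv hx, ModelWithCorners.range_eq_univ, mfderivWithin_univ]
  rfl

lemma chartCoframe_eq (hx : x ∈ (extChartAt 𝓘(ℝ, E) p).target) :
    chartCoframe p x = (trivializationAt E (TangentSpace 𝓘(ℝ, E)) p).continuousLinearMapAt ℝ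
      ((extChartAt 𝓘(ℝ, E) p).symm x) := by
  have : IsManifold 𝓘(ℝ, E) 1 M := IsManifold.of_le (n := ∞) (by norm_cast)
  rw [TangentBundle.continuousLinearMapAt_trivializationAt (symm_mem_chart_source hx)]
  rfl

lemma symm_mem_baseSet (hx : x ∈ (extChartAt 𝓘(ℝ, E) p).target) :
    (extChartAt 𝓘(ℝ, E) p).symm x ∈
      (trivializationAt E (TangentSpace 𝓘(ℝ, E) (M := M)) p).baseSet := by
  rw [TangentBundle.trivializationAt_baseSet]
  exact symm_mem_chart_source hx

lemma chartCoframe_chartFrame (hx : x ∈ (extChartAt 𝓘(ℝ, E) p).target) (u : E) :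
    chartCoframe p x (chartFrame p x u) = u := by
  rw [chartFrame_eq_symmL hx, chartCoframe_eq hx]
  exact Trivialization.continuousLinearMapAt_symmL _ (symm_mem_baseSet hx) u

lemma chartFrame_chartCoframe (hx : x ∈ (extChartAt 𝓘(ℝ, E) p).target)
    (u : TangentSpace 𝓘(ℝ, E) ((extChartAt 𝓘(ℝ, E) p).symm x)) :
    chartFrame p x (chartCoframe p x u) = u := by
  rw [chartFrame_eq_symmL hx, chartCoframe_eq hx]
  exact Trivialization.symmL_continuousLinearMapAt _ (symm_mem_baseSet hx) u

lemma contMDiffAt_extChartAt_symm' (hx : x ∈ (extChartAt 𝓘(ℝ, E) p).target) :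
    ContMDiffAt 𝓘(ℝ, E) 𝓘(ℝ, E) ∞ (extChartAt 𝓘(ℝ, E) p).symm x :=
  (contMDiffOn_extChartAt_symm p).contMDiffAt ((isOpen_extChartAt_target p).mem_nhds hx)

/-- A smooth section of a vector bundle has smooth components in a chart. -/
lemma contDiffAt_trivializationAt_symm {F : Type*} [NormedAddCommGroup F] [NormedSpace ℝ F]
    {V : M → Type*} [TopologicalSpace (TotalSpace F V)] [∀ q, TopologicalSpace (V q)]
    [∀ q, AddCommGroup (V q)] [∀ q, Module ℝ (V q)] [FiberBundle F V] [VectorBundle ℝ F V]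
    [ContMDiffVectorBundle ∞ F V 𝓘(ℝ, E)]
    {s : ∀ q, V q} (hs : ContMDiff 𝓘(ℝ, E) (𝓘(ℝ, E).prod 𝓘(ℝ, F)) ∞
      (fun q => TotalSpace.mk' F q (s q)))
    (hx : x ∈ (extChartAt 𝓘(ℝ, E) p).target)
    (hx' : (extChartAt 𝓘(ℝ, E) p).symm x ∈ (trivializationAt F V p).baseSet) :
    ContDiffAt ℝ ∞ (fun y => (trivializationAt F V p
      ⟨(extChartAt 𝓘(ℝ, E) p).symm y, s ((extChartAt 𝓘(ℝ, E) p).symm y)⟩).2) x := by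
  have h := ((trivializationAt F V p).contMDiffAt_section_iff hx').1 (hs _)
  exact (h.comp x (contMDiffAt_extChartAt_symm' hx)).contDiffAt

namespace StructureTensors

variable {S : StructureTensors E M}

lemma IsParacontactMetric.contDiffAt_chartξ (hS : S.IsParacontactMetric)
    (hx : x ∈ (extChartAt 𝓘(ℝ, E) p).target) : ContDiffAt ℝ ∞ (S.chartξ p) x := by
  refine (contDiffAt_trivializationAt_symm hS.smooth_ξ hx
    (symm_mem_baseSet hx)).congr_of_eventuallyEq ?_
  filter_upwards [(isOpen_extChartAt_target p).mem_nhds hx] with y hy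
  rw [chartξ, chartCoframe_eq hy, Trivialization.continuousLinearMapAt_apply,
    Trivialization.coe_linearMapAt_of_mem _ (symm_mem_baseSet hy)]

lemma IsParacontactMetric.contDiffAt_chartφ (hS : S.IsParacontactMetric)
    (hx : x ∈ (extChartAt 𝓘(ℝ, E) p).target) : ContDiffAt ℝ ∞ (S.chartφ p) x := by
  refine (contDiffAt_trivializationAt_symm hS.smooth_φ hx
    ⟨symm_mem_baseSet hx, symm_mem_baseSet hx⟩).congr_of_eventuallyEq ?_
  filter_upwards [(isOpen_extChartAt_target p).mem_nhds hx] with y hy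
  rw [hom_trivializationAt_apply, chartφ, chartFrame_eq_symmL hy, chartCoframe_eq hy]
  rfl

lemma IsParacontactMetric.contDiffAt_chartη (hS : S.IsParacontactMetric)
    (hx : x ∈ (extChartAt 𝓘(ℝ, E) p).target) : ContDiffAt ℝ ∞ (S.chartη p) x := by
  refine (contDiffAt_trivializationAt_symm hS.smooth_η hx
    ⟨symm_mem_baseSet hx, Set.mem_univ _⟩).congr_of_eventuallyEq ?_
  filter_upwards [(isOpen_extChartAt_target p).mem_nhds hx] with y hy
  rw [hom_trivializationAt_apply, chartη, chartFrame_eq_symmL hy]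
  ext v
  simp only [ContinuousLinearMap.inCoordinates, Trivial.fiberBundle_trivializationAt',
    Trivial.continuousLinearMapAt_trivialization]
  rfl

lemma IsParacontactMetric.contDiffAt_chartMetric (hS : S.IsParacontactMetric)
    (hx : x ∈ (extChartAt 𝓘(ℝ, E) p).target) : ContDiffAt ℝ ∞ (chartMetric S.g p) x := by
  refine (contDiffAt_trivializationAt_symm hS.smooth_g hx
    ⟨symm_mem_baseSet hx, symm_mem_baseSet hx, Set.mem_univ _⟩).congr_of_eventuallyEq ?_
  filter_upwards [(isOpen_extChartAt_target p).mem_nhds hx] with y hy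
  rw [hom_trivializationAt_apply]
  ext u v
  rw [chartMetric_apply, chartFrame_eq_symmL hy, inCoordinates_apply_eq₂ (symm_mem_baseSet hy)
    (symm_mem_baseSet hy) (Set.mem_univ _)]
  simp only [Trivial.fiberBundle_trivializationAt', Trivial.linearMapAt_trivialization,
    Trivialization.symmL_apply _ (symm_mem_baseSet hy), LinearMap.id_apply]

end StructureTensors

end Chart

/-! ### Derivatives and Lie brackets in the preferred chart -/

section Chart

variable {E : Type*} [NormedAddCommGroup E] [NormedSpace ℝ E]
  {M : Type*} [TopologicalSpace M] [ChartedSpace E M] [IsManifold 𝓘(ℝ, E) ∞ M]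
  {p : M} {x : E}

variable (p) in
/-- The vector field with constant components `u` in the preferred chart at `p`. Its values outside
the domain of the chart are irrelevant. -/
def constField (u : E) (q : M) : TangentSpace 𝓘(ℝ, E) q :=
  (trivializationAt E (TangentSpace 𝓘(ℝ, E)) p).symmL ℝ q u

lemma constField_symm (hx : x ∈ (extChartAt 𝓘(ℝ, E) p).target) (u : E) :
    constField p u ((extChartAt 𝓘(ℝ, E) p).symm x) = chartFrame p x u := by
  rw [chartFrame_eq_symmL hx, constField]

lemma SmoothFieldAt.contMDiffAt {X : ∀ q : M, TangentSpace 𝓘(ℝ, E) q} {q : M}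
    (hX : SmoothFieldAt X q) : ContMDiffAt 𝓘(ℝ, E) (𝓘(ℝ, E).prod 𝓘(ℝ, E)) ∞
      (fun r => (⟨r, X r⟩ : TangentBundle 𝓘(ℝ, E) M)) q :=
  hX.self_of_nhds

lemma smoothFieldAt_constField (hx : x ∈ (extChartAt 𝓘(ℝ, E) p).target) (u : E) :
    SmoothFieldAt (constField p u) ((extChartAt 𝓘(ℝ, E) p).symm x) := by
  set e := trivializationAt E (TangentSpace 𝓘(ℝ, E) (M := M)) p
  filter_upwards [e.open_baseSet.mem_nhds (symm_mem_baseSet hx)] with q hq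
  refine (e.contMDiffAt_section_iff hq).2 ?_
  refine (contMDiffAt_const (c := u)).congr_of_eventuallyEq ?_
  filter_upwards [e.open_baseSet.mem_nhds hq] with r hr
  have h := e.continuousLinearMapAt_symmL (R := ℝ) hr u
  rwa [e.continuousLinearMapAt_apply ℝ, e.coe_linearMapAt_of_mem hr] at h

lemma mvfderiv_chartFrame {f : M → ℝ} (hx : x ∈ (extChartAt 𝓘(ℝ, E) p).target)
    (hf : MDifferentiableAt 𝓘(ℝ, E) 𝓘(ℝ, ℝ) f ((extChartAt 𝓘(ℝ, E) p).symm x)) (u : E) :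
    mvfderiv 𝓘(ℝ, E) f ((extChartAt 𝓘(ℝ, E) p).symm x) (chartFrame p x u) =
      fderiv ℝ (fun y => f ((extChartAt 𝓘(ℝ, E) p).symm y)) x u := by
  have h := mvfderiv_comp_apply (I := 𝓘(ℝ, E)) (I' := 𝓘(ℝ, E)) (g := f) x hf
    ((contMDiffAt_extChartAt_symm' hx).mdifferentiableAt (by simp)) u
  refine h.symm.trans ?_
  rw [mvfderiv, mfderiv_eq_fderiv]
  rfl

lemma mpullback_extChartAt_symm (hx : x ∈ (extChartAt 𝓘(ℝ, E) p).target)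
    (X : ∀ q : M, TangentSpace 𝓘(ℝ, E) q) :
    VectorField.mpullback 𝓘(ℝ, E) 𝓘(ℝ, E) (extChartAt 𝓘(ℝ, E) p).symm X x =
      chartCoframe p x (X _) := by
  rw [VectorField.mpullback_apply]
  exact congrArg (· (X _)) (ContinuousLinearMap.inverse_eq (f := chartFrame p x)
    (g := chartCoframe p x) (by ext u; exact chartFrame_chartCoframe hx u)
    (by ext u; exact chartCoframe_chartFrame hx u))

lemma mlieBracket_eq_lieBracket (V W : ∀ x : E, TangentSpace 𝓘(ℝ, E) x) (x : E) :
    VectorField.mlieBracket 𝓘(ℝ, E) V W x = VectorField.lieBracket ℝ V W x := by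
  have h := congrFun
    (VectorField.mlieBracketWithin_eq_lieBracketWithin (𝕜 := ℝ) (V := V) (W := W)
      (s := Set.univ)) x
  rw [VectorField.mlieBracketWithin_univ] at h
  exact h.trans (congrFun VectorField.lieBracketWithin_univ x)

lemma chartCoframe_mlieBracket [CompleteSpace E] (hx : x ∈ (extChartAt 𝓘(ℝ, E) p).target)
    {X Y : ∀ q : M, TangentSpace 𝓘(ℝ, E) q}
    (hX : SmoothFieldAt X ((extChartAt 𝓘(ℝ, E) p).symm x))
    (hY : SmoothFieldAt Y ((extChartAt 𝓘(ℝ, E) p).symm x)) :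
    chartCoframe p x (VectorField.mlieBracket 𝓘(ℝ, E) X Y ((extChartAt 𝓘(ℝ, E) p).symm x)) =
      VectorField.lieBracket ℝ (fun y => chartCoframe p y (X _))
        (fun y => chartCoframe p y (Y _)) x := by
  have : IsManifold 𝓘(ℝ, E) (minSmoothness ℝ 2) M :=
    IsManifold.of_le (n := ∞) (by simp; norm_cast)
  have h := VectorField.mpullback_mlieBracket (I := 𝓘(ℝ, E)) (I' := 𝓘(ℝ, E)) (n := ∞)
    (hX.contMDiffAt.mdifferentiableAt (by simp)) (hY.contMDiffAt.mdifferentiableAt (by simp))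
    (contMDiffAt_extChartAt_symm' hx) (by simp; norm_cast)
  rw [mpullback_extChartAt_symm hx] at h
  refine h.trans ((mlieBracket_eq_lieBracket _ _ _).trans ?_)
  have hev (Z : ∀ q : M, TangentSpace 𝓘(ℝ, E) q) :
      VectorField.mpullback 𝓘(ℝ, E) 𝓘(ℝ, E) (extChartAt 𝓘(ℝ, E) p).symm Z =ᶠ[nhds x]
        fun y => chartCoframe p y (Z _) := by
    filter_upwards [(isOpen_extChartAt_target p).mem_nhds hx] with y hy
    exact mpullback_extChartAt_symm hy Z
  exact (hev X).lieBracket_vectorField_eq (hev Y)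

namespace StructureTensors.IsParacontactMetric

variable {S : StructureTensors E M}

lemma smoothFieldAt_ξ (hS : S.IsParacontactMetric) (q : M) : SmoothFieldAt S.ξ q :=
  Eventually.of_forall fun r => hS.smooth_ξ r

lemma smoothFieldAt_φ (hS : S.IsParacontactMetric) {X : ∀ q : M, TangentSpace 𝓘(ℝ, E) q} {q : M}
    (hX : SmoothFieldAt X q) : SmoothFieldAt (fun r => S.φ r (X r)) q := by
  filter_upwards [hX] with r hr
  exact (hS.smooth_φ r).clm_bundle_apply hr

lemma mdifferentiableAt_η (hS : S.IsParacontactMetric) {X : ∀ q : M, TangentSpace 𝓘(ℝ, E) q}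
    {q : M} (hX : SmoothFieldAt X q) :
    MDifferentiableAt 𝓘(ℝ, E) 𝓘(ℝ, ℝ) (fun r => S.η r (X r)) q := by
  have h : ContMDiffAt 𝓘(ℝ, E) (𝓘(ℝ, E).prod 𝓘(ℝ, ℝ)) ∞
      (fun r => TotalSpace.mk' ℝ (E := Trivial M ℝ) r (S.η r (X r))) q :=
    (hS.smooth_η q).clm_bundle_apply hX.contMDiffAt
  rw [contMDiffAt_section] at h
  exact h.mdifferentiableAt (by simp)

end StructureTensors.IsParacontactMetric

end Chart

/-! ### The structure equations in the preferred chart -/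

section Chart

variable {E : Type*} [NormedAddCommGroup E] [NormedSpace ℝ E]
  {M : Type*} [TopologicalSpace M] [ChartedSpace E M] [IsManifold 𝓘(ℝ, E) ∞ M]
  {p : M} {x : E}

namespace StructureTensors

variable {S : StructureTensors E M}

lemma chartFrame_chartφ (hx : x ∈ (extChartAt 𝓘(ℝ, E) p).target) (u : E) :
    chartFrame p x (S.chartφ p x u) = S.φ _ (chartFrame p x u) :=
  chartFrame_chartCoframe hx _

lemma chartφ_chartCoframe (hx : x ∈ (extChartAt 𝓘(ℝ, E) p).target)
    (u : TangentSpace 𝓘(ℝ, E) ((extChartAt 𝓘(ℝ, E) p).symm x)) :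
    S.chartφ p x (chartCoframe p x u) = chartCoframe p x (S.φ _ u) :=
  congrArg (fun w => chartCoframe p x (S.φ _ w)) (chartFrame_chartCoframe hx u)

lemma chartη_chartCoframe (hx : x ∈ (extChartAt 𝓘(ℝ, E) p).target)
    (u : TangentSpace 𝓘(ℝ, E) ((extChartAt 𝓘(ℝ, E) p).symm x)) :
    S.chartη p x (chartCoframe p x u) = S.η _ u :=
  congrArg (S.η _) (chartFrame_chartCoframe hx u)

lemma chartMetric_chartCoframe (hx : x ∈ (extChartAt 𝓘(ℝ, E) p).target)
    (u v : TangentSpace 𝓘(ℝ, E) ((extChartAt 𝓘(ℝ, E) p).symm x)) :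
    chartMetric S.g p x (chartCoframe p x u) (chartCoframe p x v) = S.g _ u v := by
  rw [chartMetric_apply, chartFrame_chartCoframe hx, chartFrame_chartCoframe hx]

lemma IsParacontactMetric.dη_constField [CompleteSpace E] (hS : S.IsParacontactMetric)
    (hx : x ∈ (extChartAt 𝓘(ℝ, E) p).target) (u v : E) :
    S.dη (constField p u) (constField p v) ((extChartAt 𝓘(ℝ, E) p).symm x) =
      (1 / 2 : ℝ) * (fderiv ℝ (S.chartη p) x u v - fderiv ℝ (S.chartη p) x v u) := by
  have htarget := (isOpen_extChartAt_target (I := 𝓘(ℝ, E)) p).mem_nhds hx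
  have hη (a b : E) : mvfderiv 𝓘(ℝ, E) (fun q => S.η q (constField p b q))
      ((extChartAt 𝓘(ℝ, E) p).symm x) (chartFrame p x a) = fderiv ℝ (S.chartη p) x a b := by
    rw [mvfderiv_chartFrame hx (hS.mdifferentiableAt_η (smoothFieldAt_constField hx b))]
    have h1 : (fun y => S.η _ (constField p b ((extChartAt 𝓘(ℝ, E) p).symm y))) =ᶠ[nhds x]
        fun y => S.chartη p y b := by
      filter_upwards [htarget] with y hy
      rw [constField_symm hy]
      rfl
    rw [h1.fderiv_eq, fderiv_clm_apply ((hS.contDiffAt_chartη hx).differentiableAt (by simp))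
      (differentiableAt_const _)]
    simp
  have hbr : S.η _ (VectorField.mlieBracket 𝓘(ℝ, E) (constField p u) (constField p v)
      ((extChartAt 𝓘(ℝ, E) p).symm x)) = 0 := by
    have h1 (a : E) : (fun y => chartCoframe p y (constField p a _)) =ᶠ[nhds x] fun _ => a := by
      filter_upwards [htarget] with y hy
      rw [constField_symm hy, chartCoframe_chartFrame hy]
    rw [← chartη_chartCoframe hx, chartCoframe_mlieBracket hx (smoothFieldAt_constField hx u)
      (smoothFieldAt_constField hx v), (h1 u).lieBracket_vectorField_eq (h1 v)]
    simp [VectorField.lieBracket]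
  rw [dη, hbr, constField_symm hx, constField_symm hx, hη, hη, sub_zero]

lemma IsParaSasakian.nijenhuis_constField_ξ [CompleteSpace E] (hS : S.IsParaSasakian)
    (hx : x ∈ (extChartAt 𝓘(ℝ, E) p).target) (v : E) :
    S.chartφ p x (S.chartφ p x (fderiv ℝ (S.chartξ p) x v))
      - S.chartφ p x (fderiv ℝ (S.chartξ p) x (S.chartφ p x v)
        - fderiv ℝ (S.chartφ p) x (S.chartξ p x) v) = 0 := by
  have hS' := hS.toIsParacontactMetric
  have htarget := (isOpen_extChartAt_target (I := 𝓘(ℝ, E)) p).mem_nhds hx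
  set q := (extChartAt 𝓘(ℝ, E) p).symm x
  have hv := smoothFieldAt_constField hx v
  have hξ := hS'.smoothFieldAt_ξ q
  have h := hS.nijenhuis_eq q (constField p v) S.ξ hv hξ
  have hφξ : (fun r => S.φ r (S.ξ r)) = 0 := funext hS.φ_ξ
  rw [← hS.g_φ q _ _ hv hξ, hS.φ_ξ, map_zero, mul_zero, zero_smul, nijenhuis, hφξ,
    VectorField.mlieBracket_zero_right, VectorField.mlieBracket_zero_right] at h
  have h1 : (fun y => chartCoframe p y (constField p v _)) =ᶠ[nhds x] fun _ => v := by
    filter_upwards [htarget] with y hy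
    rw [constField_symm hy, chartCoframe_chartFrame hy]
  have h2 : (fun y => chartCoframe p y (S.φ _ (constField p v _))) =ᶠ[nhds x]
      fun y => S.chartφ p y v := by
    filter_upwards [htarget] with y hy
    rw [constField_symm hy]
    rfl
  have b1 : chartCoframe p x (VectorField.mlieBracket 𝓘(ℝ, E) (constField p v) S.ξ q) =
      fderiv ℝ (S.chartξ p) x v := by
    rw [chartCoframe_mlieBracket hx hv hξ, h1.lieBracket_vectorField_eq EventuallyEq.rfl]
    simp only [VectorField.lieBracket, fderiv_fun_const]
    simp
    rfl
  have b2 : chartCoframe p x (VectorField.mlieBracket 𝓘(ℝ, E)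
      (fun r => S.φ r (constField p v r)) S.ξ q) =
      fderiv ℝ (S.chartξ p) x (S.chartφ p x v) - fderiv ℝ (S.chartφ p) x (S.chartξ p x) v := by
    rw [chartCoframe_mlieBracket hx (hS'.smoothFieldAt_φ hv) hξ,
      h2.lieBracket_vectorField_eq EventuallyEq.rfl]
    simp only [VectorField.lieBracket]
    rw [fderiv_clm_apply ((hS'.contDiffAt_chartφ hx).differentiableAt (by simp))
      (differentiableAt_const _)]
    simp
    rfl
  have h3 := congrArg (chartCoframe p x) h
  simp only [Pi.zero_apply, map_zero, map_add, map_neg, sub_zero, zero_sub] at h3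
  rw [← b1, ← b2, chartφ_chartCoframe hx, chartφ_chartCoframe hx, chartφ_chartCoframe hx,
    sub_eq_add_neg, add_comm]
  exact h3

/-- A paraSasakian structure on a manifold induces one on the target of each chart. -/
theorem IsParaSasakian.isLocalParaSasakian [CompleteSpace E] (hS : S.IsParaSasakian) (p : M) :
    IsLocalParaSasakian (extChartAt 𝓘(ℝ, E) p).target (S.chartφ p) (S.chartξ p) (S.chartη p)
      (chartMetric S.g p) := by
  have hS' := hS.toIsParacontactMetric
  refine ⟨isOpen_extChartAt_target p, fun _ hx => hS'.contDiffAt_chartφ hx,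
    fun _ hx => hS'.contDiffAt_chartξ hx, fun _ hx => hS'.contDiffAt_chartη hx,
    fun _ hx => hS'.contDiffAt_chartMetric hx, fun x _ u v => ?_, fun x hx u hu => ?_,
    fun x hx => ?_, fun x hx u => ?_, fun x hx => ?_, fun x hx u => ?_, fun x hx u v => ?_,
    fun x hx u v => ?_, fun _ hx v => hS.nijenhuis_constField_ξ hx v⟩
  · rw [chartMetric_apply, chartMetric_apply, hS'.g_symm]
  · have h := hS'.g_nondegenerate _ (chartFrame p x u) fun v => by
      rw [← chartFrame_chartCoframe hx v, ← chartMetric_apply, hu]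
    rw [← chartCoframe_chartFrame hx u, h, map_zero]
  · rw [chartξ, chartφ_chartCoframe hx, hS'.φ_ξ, map_zero]
  · rw [chartφ, ContinuousLinearMap.comp_apply, chartη_chartCoframe hx]
    exact hS'.η_φ _ _
  · rw [chartξ, chartη_chartCoframe hx, hS'.η_ξ]
  · rw [← chartCoframe_chartFrame hx u, chartφ_chartCoframe hx, chartφ_chartCoframe hx, hS'.φ_φ,
      map_sub, map_smul, chartη_chartCoframe hx, chartξ]
  · rw [← chartCoframe_chartFrame hx u, ← chartCoframe_chartFrame hx v, chartφ_chartCoframe hx,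
      chartφ_chartCoframe hx, chartη_chartCoframe hx, chartη_chartCoframe hx,
      chartMetric_chartCoframe hx, chartMetric_chartCoframe hx, hS'.g_φ_φ]
  · have h := hS'.g_φ _ _ _ (smoothFieldAt_constField hx u) (smoothFieldAt_constField hx v)
    rw [hS'.dη_constField hx, constField_symm hx, constField_symm hx] at h
    rw [chartMetric_apply, chartFrame_chartφ hx, h]

end StructureTensors

end Chart

/-! ### The `D`-homothetic transformation on the manifold -/

section Transformation

variable {E : Type*} [NormedAddCommGroup E] [NormedSpace ℝ E]
  {M : Type*} [TopologicalSpace M] [ChartedSpace E M]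

/-- The chart expression at the image of `p` itself. The image of `p` under the chart and its inverse
is only propositionally equal to `p`, whence the generalization to a point `q`. -/
lemma chartMetric_chartAt [IsManifold 𝓘(ℝ, E) ∞ M] (S : StructureTensors E M) (p : M)
    (u v : TangentSpace 𝓘(ℝ, E) p) :
    chartMetric S.g p (extChartAt 𝓘(ℝ, E) p p)
      (mfderiv 𝓘(ℝ, E) 𝓘(ℝ, E) (extChartAt 𝓘(ℝ, E) p) p u)
      (mfderiv 𝓘(ℝ, E) 𝓘(ℝ, E) (extChartAt 𝓘(ℝ, E) p) p v) = S.g p u v := by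
  have key : ∀ q, (extChartAt 𝓘(ℝ, E) p).symm (extChartAt 𝓘(ℝ, E) p p) = q →
      ∀ u v : TangentSpace 𝓘(ℝ, E) q, chartMetric S.g p (extChartAt 𝓘(ℝ, E) p p)
        (mfderiv 𝓘(ℝ, E) 𝓘(ℝ, E) (extChartAt 𝓘(ℝ, E) p) q u)
        (mfderiv 𝓘(ℝ, E) 𝓘(ℝ, E) (extChartAt 𝓘(ℝ, E) p) q v) = S.g q u v := by
    rintro q rfl u v
    exact StructureTensors.chartMetric_chartCoframe (mem_extChartAt_target p) u v
  exact key p (extChartAt_to_inv p) u v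

lemma chartη_chartAt [IsManifold 𝓘(ℝ, E) ∞ M] (S : StructureTensors E M) (p : M)
    (u : TangentSpace 𝓘(ℝ, E) p) :
    S.chartη p (extChartAt 𝓘(ℝ, E) p p)
      (mfderiv 𝓘(ℝ, E) 𝓘(ℝ, E) (extChartAt 𝓘(ℝ, E) p) p u) = S.η p u := by
  have key : ∀ q, (extChartAt 𝓘(ℝ, E) p).symm (extChartAt 𝓘(ℝ, E) p p) = q →
      ∀ u : TangentSpace 𝓘(ℝ, E) q, S.chartη p (extChartAt 𝓘(ℝ, E) p p)
        (mfderiv 𝓘(ℝ, E) 𝓘(ℝ, E) (extChartAt 𝓘(ℝ, E) p) q u) = S.η q u := by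
    rintro q rfl u
    exact StructureTensors.chartη_chartCoframe (mem_extChartAt_target p) u
  exact key p (extChartAt_to_inv p) u

lemma chartφ_chartAt [IsManifold 𝓘(ℝ, E) ∞ M] (S : StructureTensors E M) (p : M)
    (u : TangentSpace 𝓘(ℝ, E) p) :
    S.chartφ p (extChartAt 𝓘(ℝ, E) p p)
      (mfderiv 𝓘(ℝ, E) 𝓘(ℝ, E) (extChartAt 𝓘(ℝ, E) p) p u) =
        (mfderiv 𝓘(ℝ, E) 𝓘(ℝ, E) (extChartAt 𝓘(ℝ, E) p) p (S.φ p u)) := by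
  have key : ∀ q, (extChartAt 𝓘(ℝ, E) p).symm (extChartAt 𝓘(ℝ, E) p p) = q →
      ∀ u : TangentSpace 𝓘(ℝ, E) q, S.chartφ p (extChartAt 𝓘(ℝ, E) p p)
        (mfderiv 𝓘(ℝ, E) 𝓘(ℝ, E) (extChartAt 𝓘(ℝ, E) p) q u) =
          (mfderiv 𝓘(ℝ, E) 𝓘(ℝ, E) (extChartAt 𝓘(ℝ, E) p) q (S.φ q u)) := by
    rintro q rfl u
    exact StructureTensors.chartφ_chartCoframe (mem_extChartAt_target p) u
  exact key p (extChartAt_to_inv p) u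

namespace StructureTensors

variable (S : StructureTensors E M) (α : ℝ)

lemma dHomothetic_g_apply (p : M) (u v : TangentSpace 𝓘(ℝ, E) p) :
    (S.dHomothetic α).g p u v = α * S.g p u v + (α ^ 2 - α) * (S.η p u * S.η p v) := by
  simp [dHomothetic]

lemma chartMetric_dHomothetic (p : M) :
    chartMetric (S.dHomothetic α).g p = dHomotheticForm α (S.chartη p) (chartMetric S.g p) := by
  ext x u v
  rw [IsLocalParaSasakian.dHomotheticForm_apply, chartMetric_apply, dHomothetic_g_apply]
  rfl

variable [IsManifold 𝓘(ℝ, E) ∞ M] {S α}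

lemma IsParacontactMetric.smooth_η_smulRight_η (hS : S.IsParacontactMetric) :
    ContMDiff 𝓘(ℝ, E) (𝓘(ℝ, E).prod 𝓘(ℝ, E →L[ℝ] E →L[ℝ] ℝ)) ∞
      (fun p : M => TotalSpace.mk' (E →L[ℝ] E →L[ℝ] ℝ)
        (E := fun q : M => TangentSpace 𝓘(ℝ, E) q →L[ℝ] TangentSpace 𝓘(ℝ, E) q →L[ℝ] ℝ)
        p ((S.η p).smulRight (S.η p))) := by
  intro p
  have h := hS.smooth_η p
  rw [contMDiffAt_section] at h ⊢
  have h2 := (contMDiffAt_const (c := ContinuousLinearMap.smulRightL ℝ E (E →L[ℝ] ℝ))).clm_apply h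
    |>.clm_apply h
  refine h2.congr_of_eventuallyEq ?_
  filter_upwards [(trivializationAt E (TangentSpace 𝓘(ℝ, E) (M := M)) p).open_baseSet.mem_nhds
    (mem_baseSet_trivializationAt E _ p)] with q hq
  rw [hom_trivializationAt_apply, hom_trivializationAt_apply]
  ext u v
  rw [inCoordinates_apply_eq₂ hq hq (Set.mem_univ _)]
  simp only [ContinuousLinearMap.inCoordinates, Trivial.fiberBundle_trivializationAt',
    Trivial.linearMapAt_trivialization, Trivial.continuousLinearMapAt_trivialization,
    ← Trivialization.symmL_apply (R := ℝ) _ hq]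
  rfl

lemma IsParacontactMetric.dη_dHomothetic (hS : S.IsParacontactMetric)
    {X Y : ∀ q : M, TangentSpace 𝓘(ℝ, E) q} {p : M} (hX : SmoothFieldAt X p)
    (hY : SmoothFieldAt Y p) : (S.dHomothetic α).dη X Y p = α * S.dη X Y p := by
  have h {Z : ∀ q : M, TangentSpace 𝓘(ℝ, E) q} (hZ : SmoothFieldAt Z p) :
      mvfderiv 𝓘(ℝ, E) (fun q => (S.dHomothetic α).η q (Z q)) p =
        α • mvfderiv 𝓘(ℝ, E) (fun q => S.η q (Z q)) p := by
    have h1 := mvfderiv_smul (I := 𝓘(ℝ, E)) (a := fun _ : M => α) (x := p)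
      mdifferentiableAt_const (hS.mdifferentiableAt_η hZ)
    rw [mvfderiv_const] at h1
    refine Eq.trans h1 ?_
    ext v
    simp
  have h2 (v : TangentSpace 𝓘(ℝ, E) p) : (S.dHomothetic α).η p v = α * S.η p v := rfl
  rw [dη, dη, h hX, h hY, h2]
  simp only [smul_apply, smul_eq_mul]
  ring

theorem IsParacontactMetric.dHomothetic (hS : S.IsParacontactMetric) (hα : α ≠ 0) :
    (S.dHomothetic α).IsParacontactMetric := by
  have hη (p : M) (v : TangentSpace 𝓘(ℝ, E) p) : (S.dHomothetic α).η p v = α * S.η p v := rfl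
  have hξ (p : M) : (S.dHomothetic α).ξ p = α⁻¹ • S.ξ p := rfl
  have hφ (p : M) : (S.dHomothetic α).φ p = S.φ p := rfl
  have hgξ (p : M) (u : TangentSpace 𝓘(ℝ, E) p) : S.g p u (S.ξ p) = S.η p u := by
    have h := hS.g_φ_φ p u (S.ξ p)
    rw [hS.φ_ξ, map_zero, hS.η_ξ] at h
    linarith
  refine ⟨hS.smooth_φ, hS.smooth_ξ.const_smul_section, hS.smooth_η.const_smul_section,
    hS.smooth_g.const_smul_section.add_section hS.smooth_η_smulRight_η.const_smul_section,
    fun p u v => ?_, fun p u hu => ?_, fun p => ?_, fun p u => ?_, fun p => ?_, fun p u => ?_,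
    fun p u v => ?_, fun p X Y hX hY => ?_⟩
  · rw [dHomothetic_g_apply, dHomothetic_g_apply, hS.g_symm]
    ring
  · -- Pairing with `ξ` gives `α² η(u) = 0`, after which the new metric is `α g` on `u`.
    simp only [dHomothetic_g_apply] at hu
    have h1 := hu (S.ξ p)
    rw [hgξ, hS.η_ξ] at h1
    have h2 : S.η p u = 0 := by
      have : α ^ 2 * S.η p u = 0 := by linear_combination h1
      exact (mul_eq_zero.1 this).resolve_left (pow_ne_zero 2 hα)
    refine hS.g_nondegenerate p u fun v => ?_
    have h3 := hu v
    rw [h2, zero_mul, mul_zero, add_zero] at h3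
    exact (mul_eq_zero.1 h3).resolve_left hα
  · rw [hφ, hξ, map_smul, hS.φ_ξ, smul_zero]
  · rw [hφ, hη, hS.η_φ, mul_zero]
  · rw [hη, hξ, map_smul, hS.η_ξ, smul_eq_mul, mul_one, mul_inv_cancel₀ hα]
  · rw [hφ, hξ, hη, hS.φ_φ, smul_smul, mul_right_comm, mul_inv_cancel₀ hα, one_mul]
  · rw [hφ, dHomothetic_g_apply, dHomothetic_g_apply, hS.g_φ_φ, hS.η_φ, hη, hη]
    ring
  · rw [hS.dη_dHomothetic hX hY, ← hS.g_φ p X Y hX hY, hφ, dHomothetic_g_apply, hS.η_φ]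
    ring

theorem IsParaSasakian.dHomothetic (hS : S.IsParaSasakian) (hα : α ≠ 0) :
    (S.dHomothetic α).IsParaSasakian := by
  refine ⟨hS.toIsParacontactMetric.dHomothetic hα, fun p X Y hX hY => ?_⟩
  have h : (S.dHomothetic α).nijenhuis X Y p = S.nijenhuis X Y p := rfl
  have hξ : (S.dHomothetic α).ξ p = α⁻¹ • S.ξ p := rfl
  rw [h, hS.nijenhuis_eq p X Y hX hY, hS.toIsParacontactMetric.dη_dHomothetic hX hY, hξ, smul_smul]
  congr 1
  field_simp

/-- On the section spanned by a horizontal vector `u` and `φ u`, the Riemann tensor changes by a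
factor `α` and a multiple of `g(u, u)²`. -/
lemma IsParaSasakian.riemann_dHomothetic [FiniteDimensional ℝ E] (hS : S.IsParaSasakian)
    (hα : α ≠ 0) (p : M) {u : TangentSpace 𝓘(ℝ, E) p} (hu : S.η p u = 0) :
    riemann (S.dHomothetic α).g p u (S.φ p u) (S.φ p u) u =
      α * (riemann S.g p u (S.φ p u) (S.φ p u) u + 3 * (1 - α) * S.g p u u ^ 2) := by
  have : CompleteSpace E := FiniteDimensional.complete ℝ E
  have h := hS.isLocalParaSasakian p
  have h' := (hS.dHomothetic hα).isLocalParaSasakian p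
  rw [chartMetric_dHomothetic] at h'
  have key := h.dHomotheticForm_chartCurvature_φ h' (mem_extChartAt_target p)
    ((chartη_chartAt S p u).trans hu)
  rw [chartφ_chartAt, chartMetric_chartAt, ← chartMetric_dHomothetic] at key
  exact key

end StructureTensors

end Transformation

end ParaSasaki

end

theorem theorem4p3 (n : ℕ) {M : Type*} [TopologicalSpace M]
    [ChartedSpace (EuclideanSpace ℝ (Fin (2 * n + 1))) M]
    [IsManifold 𝓘(ℝ, EuclideanSpace ℝ (Fin (2 * n + 1))) ∞ M]
    (S : ParaSasaki.StructureTensors (EuclideanSpace ℝ (Fin (2 * n + 1))) M)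
    (hS : S.IsParaSasakian) (k : ℝ) (hk : S.HasConstantParaholomorphicCurvature k)
    (α : ℝ) (hα : 0 < α) :
    (S.dHomothetic α).IsParaSasakian ∧
      (S.dHomothetic α).HasConstantParaholomorphicCurvature ((k - 3) / α + 3) := by
  refine ⟨hS.dHomothetic hα.ne', fun p v hv => ?_⟩
  have hφ : (S.dHomothetic α).φ p = S.φ p := rfl
  rw [hφ] at hv ⊢
  set u := S.φ p v with hu
  have hηu : S.η p u = 0 := hS.η_φ p v
  have hguu : (S.dHomothetic α).g p u u = α * S.g p u u := by
    rw [S.dHomothetic_g_apply, hηu]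
    ring
  have hg : S.g p u u ≠ 0 := by
    rw [hguu] at hv
    exact right_ne_zero_of_mul hv
  have hφφ : S.g p (S.φ p u) (S.φ p u) = - S.g p u u := by
    rw [hS.g_φ_φ, hηu]
    ring
  have hφu : S.g p u (S.φ p u) = 0 := by
    have hφφu : S.φ p (S.φ p u) = u := by rw [hS.φ_φ p u, hηu, zero_smul, sub_zero]
    have h1 := hS.g_φ_φ p u (S.φ p u)
    rw [hφφu, hηu, zero_mul, add_zero, hS.g_symm p (S.φ p u) u] at h1
    linarith
  have hk' := hk p v hg
  rw [ParaSasaki.sectionalCurvature, ← hu, hφφ, hφu] at hk'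
  rw [ParaSasaki.sectionalCurvature, hS.riemann_dHomothetic hα.ne' p hηu, hguu,
    S.dHomothetic_g_apply, S.dHomothetic_g_apply, hS.η_φ, hφφ, hφu, ← hk']
  field_simp
  ring
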